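/- Call a map $f\colon X\to Y$ between real normed spaces a *phase-isometry* if $$\{\|f(x)+f(y)\|,\ \|f(x)-f(y)\|\}=\{\|x+y\|,\ \|x-y\|\}\qquad\text{for all }x,y\in X .$$ Say that $f$ is *phase-equivalent to a linear isometry* if there is a function $\varepsilon\colon X\to\{-1,1\}$ such that the map $x\mapsto\varepsilon(x)f(x)$ is a linear isometry from $X$ into $Y$. **Corollary 2.9.** Let $\mu$ be an arbitrary measure on a measurable space, let $1<p<\infty$, let $X=L^p(\mu)$ be the real normed space of ($\mu$-a.e. classes of) real-valued $p$-integrable functions with its usual norm, and let $Y$ be any real normed space. If $f\colon X\to Y$ is a surjective phase-isometry, then $f$ is phase-equivalent to a linear isometry. -/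

import Mathlib

/-- A map `f : X → Y` between real normed spaces is a phase-isometry if the (unordered) sets
`{‖f x + f y‖, ‖f x - f y‖}` and `{‖x + y‖, ‖x - y‖}` coincide for all `x y`. -/
def IsPhaseIsometry {X Y : Type*} [NormedAddCommGroup X] [NormedSpace ℝ X]
    [NormedAddCommGroup Y] [NormedSpace ℝ Y] (f : X → Y) : Prop :=
  ∀ x y : X, ({‖f x + f y‖, ‖f x - f y‖} : Set ℝ) = {‖x + y‖, ‖x - y‖}

/-- A map `f : X → Y` is phase-equivalent to a linear isometry if there is a phase function
`ε : X → {-1, 1}` such that the pointwise product `ε f` is a (real-)linear isometry. -/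
def IsPhaseEquivalentToLinearIsometry {X Y : Type*} [NormedAddCommGroup X] [NormedSpace ℝ X]
    [NormedAddCommGroup Y] [NormedSpace ℝ Y] (f : X → Y) : Prop :=
  ∃ ε : X → ℝ, (∀ x, ε x = -1 ∨ ε x = 1) ∧ ∃ T : X →ₗᵢ[ℝ] Y, ∀ x, ε x • f x = T x

open Filter Topology

/-! Only two features of `L^p` matter: strict convexity and a norm with directional derivatives off
0. If `g` supports `z` and `ψ` supports `f z`, comparing difference quotients of the norm gives `ψ
(f x) = ± g x` (`sq_support_apply_eq`). Hence `ψ` kills one of the four vectors `f (x + y) ± (f x ±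
f y)`, so `f z` is Birkhoff orthogonal to it. By surjectivity four closed sets cover `Y`; one has
interior, and strict convexity makes its vector zero (`map_add`). The signs are then chosen
coherently by pure algebra (`exists_linearMap_of_map_add_smul_up_to_sign`). -/

/-! ### Strict convexity and smoothness of the `L^p` norm -/

theorem abs_midpoint_rpow_le {p : ℝ} (hp : 1 < p) (u v : ℝ) :
    |(u + v) / 2| ^ p ≤ (|u| ^ p + |v| ^ p) / 2 := by
  have h1 : |(u + v) / 2| ≤ (|u| + |v|) / 2 := by
    rw [abs_div, abs_two]
    linarith [abs_add_le u v]
  have h2 := (strictConvexOn_rpow hp).convexOn.2 (abs_nonneg u) (abs_nonneg v)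
    (by norm_num : (0 : ℝ) ≤ 1 / 2) (by norm_num : (0 : ℝ) ≤ 1 / 2) (by norm_num)
  simp only [smul_eq_mul] at h2
  calc |(u + v) / 2| ^ p ≤ ((|u| + |v|) / 2) ^ p :=
        Real.rpow_le_rpow (abs_nonneg _) h1 (by linarith)
    _ = (1 / 2 * |u| + 1 / 2 * |v|) ^ p := by congr 1; ring
    _ ≤ _ := by linarith

theorem eq_of_abs_midpoint_rpow_eq {p : ℝ} (hp : 1 < p) {u v : ℝ}
    (h : |(u + v) / 2| ^ p = (|u| ^ p + |v| ^ p) / 2) : u = v := by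
  have h1 : |(u + v) / 2| ≤ (|u| + |v|) / 2 := by
    rw [abs_div, abs_two]
    linarith [abs_add_le u v]
  by_cases huv : |u| = |v|
  · rcases abs_eq_abs.1 huv with h3 | rfl
    · exact h3
    · rw [neg_add_cancel, zero_div, abs_zero, Real.zero_rpow (by linarith), abs_neg] at h
      have h4 : |v| ^ p = 0 := by linarith
      have h5 := (Real.rpow_eq_zero (abs_nonneg v) (by linarith)).1 h4
      rw [abs_eq_zero.1 h5, neg_zero]
  · exfalso
    have h2 := (strictConvexOn_rpow hp).2 (abs_nonneg u) (abs_nonneg v) huv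
      (by norm_num : (0 : ℝ) < 1 / 2) (by norm_num : (0 : ℝ) < 1 / 2) (by norm_num)
    simp only [smul_eq_mul] at h2
    have h3 : |(u + v) / 2| ^ p ≤ (1 / 2 * |u| + 1 / 2 * |v|) ^ p :=
      Real.rpow_le_rpow (abs_nonneg _) (by linarith) (by linarith)
    linarith

namespace MeasureTheory

namespace Lp

variable {Ω : Type*} [MeasurableSpace Ω] {μ : Measure Ω} {p : ENNReal}

theorem integrable_abs_rpow (hp0 : p ≠ 0) (hp : p ≠ ⊤) (g : Lp ℝ p μ) :
    Integrable (fun a => |g a| ^ p.toReal) μ := by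
  simpa using (Lp.memLp g).integrable_norm_rpow hp0 hp

theorem norm_rpow_eq_integral (hp0 : p ≠ 0) (hp : p ≠ ⊤) (g : Lp ℝ p μ) :
    ‖g‖ ^ p.toReal = ∫ a, |g a| ^ p.toReal ∂μ := by
  have hpos := ENNReal.toReal_pos hp0 hp
  have h0 : 0 ≤ ∫ a, |g a| ^ p.toReal ∂μ := integral_nonneg fun a => by positivity
  rw [Lp.norm_def, (Lp.memLp g).eLpNorm_eq_integral_rpow_norm hp0 hp,
    ENNReal.toReal_ofReal (by positivity)]
  simp only [Real.norm_eq_abs]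
  rw [← Real.rpow_mul h0, inv_mul_cancel₀ hpos.ne', Real.rpow_one]

theorem strictConvexSpace [Fact (1 ≤ p)] (hp_one : 1 < p) (hp : p ≠ ⊤) :
    StrictConvexSpace ℝ (Lp ℝ p μ) := by
  have hp0 : p ≠ 0 := (zero_lt_one.trans hp_one).ne'
  have hp1 : 1 < p.toReal := by
    rwa [← ENNReal.toReal_one, ENNReal.toReal_lt_toReal ENNReal.one_ne_top hp]
  refine StrictConvexSpace.of_norm_add_ne_two fun x y hx hy hne hxy => hne ?_
  have hix := integrable_abs_rpow hp0 hp x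
  have hiy := integrable_abs_rpow hp0 hp y
  have him := integrable_abs_rpow hp0 hp ((1 / 2 : ℝ) • (x + y))
  have hm : ‖(1 / 2 : ℝ) • (x + y)‖ = 1 := by rw [norm_smul, hxy]; norm_num
  have hnx := norm_rpow_eq_integral hp0 hp x
  have hny := norm_rpow_eq_integral hp0 hp y
  have hnm := norm_rpow_eq_integral hp0 hp ((1 / 2 : ℝ) • (x + y))
  rw [hx, Real.one_rpow] at hnx
  rw [hy, Real.one_rpow] at hny
  rw [hm, Real.one_rpow] at hnm
  have hcoe : ∀ᵐ a ∂μ, ((1 / 2 : ℝ) • (x + y)) a = (x a + y a) / 2 := by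
    filter_upwards [Lp.coeFn_smul (1 / 2 : ℝ) (x + y), Lp.coeFn_add x y] with a h1 h2
    rw [h1, Pi.smul_apply, h2, Pi.add_apply, smul_eq_mul]
    ring
  have hixy : Integrable (fun a => (|x a| ^ p.toReal + |y a| ^ p.toReal) / 2) μ :=
    (hix.add hiy).div_const 2
  -- The pointwise convexity defect is nonnegative with integral zero, so it vanishes a.e.
  have hint : ∫ a, ((|x a| ^ p.toReal + |y a| ^ p.toReal) / 2 -
      |((1 / 2 : ℝ) • (x + y)) a| ^ p.toReal) ∂μ = 0 := by
    rw [integral_sub hixy him, integral_div, integral_add hix hiy, ← hnx, ← hny, ← hnm]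
    norm_num
  rw [integral_eq_zero_iff_of_nonneg_ae (f := fun a => (|x a| ^ p.toReal + |y a| ^ p.toReal) / 2 -
      |((1 / 2 : ℝ) • (x + y)) a| ^ p.toReal) ?_ (hixy.sub him)] at hint
  · apply Lp.ext
    filter_upwards [hint, hcoe] with a h1 h2
    rw [h2, Pi.zero_apply] at h1
    exact eq_of_abs_midpoint_rpow_eq hp1 (by linarith)
  · filter_upwards [hcoe] with a h2
    rw [h2, Pi.zero_apply]
    linarith [abs_midpoint_rpow_le hp1 (x a) (y a)]

/-- Differentiate the `q`-th power of the norm under the integral, dominating on `|t| < 1`; the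
outer root is harmless because `x ≠ 0`. -/
theorem differentiableAt_norm_add_smul [Fact (1 ≤ p)] (hp_one : 1 < p) (hp : p ≠ ⊤)
    {x : Lp ℝ p μ} (hx : x ≠ 0) (y : Lp ℝ p μ) :
    DifferentiableAt ℝ (fun t : ℝ => ‖x + t • y‖) 0 := by
  have hp0 : p ≠ 0 := (zero_lt_one.trans hp_one).ne'
  have hp1 : 1 < p.toReal := by
    rwa [← ENNReal.toReal_one, ENNReal.toReal_lt_toReal ENNReal.one_ne_top hp]
  set q := p.toReal
  have hcoe : ∀ t : ℝ, ∀ᵐ a ∂μ, (x + t • y) a = x a + t * y a := fun t => by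
    filter_upwards [Lp.coeFn_smul t y, Lp.coeFn_add x (t • y)] with a h1 h2
    rw [h2, Pi.add_apply, h1, Pi.smul_apply, smul_eq_mul]
  have hnorm : ∀ t : ℝ, ‖x + t • y‖ = (∫ a, |x a + t * y a| ^ q ∂μ) ^ q⁻¹ := fun t => by
    have h : ∫ a, |(x + t • y) a| ^ q ∂μ = ∫ a, |x a + t * y a| ^ q ∂μ :=
      integral_congr_ae ((hcoe t).mono fun a h => by simp only [h])
    rw [← h, ← norm_rpow_eq_integral hp0 hp, ← Real.rpow_mul (norm_nonneg _),
      mul_inv_cancel₀ (by linarith), Real.rpow_one]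
  have hmx := (Lp.stronglyMeasurable x).measurable
  have hmy := (Lp.stronglyMeasurable y).measurable
  have hbound : Integrable (fun a => q * (|x a| + |y a|) ^ q) μ := by
    refine Integrable.const_mul ?_ q
    have h := ((Lp.memLp x).norm.add (Lp.memLp y).norm).integrable_norm_rpow hp0 hp
    refine h.congr (Eventually.of_forall fun a => ?_)
    simp only [Pi.add_apply, Real.norm_eq_abs]
    rw [abs_of_nonneg (by positivity : 0 ≤ |x a| + |y a|)]
  have hderiv := hasDerivAt_integral_of_dominated_loc_of_deriv_le (μ := μ) (x₀ := (0 : ℝ))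
    (F := fun t a => |x a + t * y a| ^ q)
    (F' := fun t a => q * |x a + t * y a| ^ (q - 2) * (x a + t * y a) * y a)
    (bound := fun a => q * (|x a| + |y a|) ^ q)
    (Metric.ball_mem_nhds (0 : ℝ) one_pos)
    (Eventually.of_forall fun t => by
      exact Measurable.aestronglyMeasurable (by fun_prop))
    (by simpa using integrable_abs_rpow hp0 hp x)
    (Measurable.aestronglyMeasurable (by fun_prop))
    (Eventually.of_forall fun a t ht => by
      have ht1 : |t| ≤ 1 := by simpa using (mem_ball_zero_iff.1 ht).le
      have h1 : |x a + t * y a| ≤ |x a| + |y a| := by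
        refine (abs_add_le _ _).trans ?_
        rw [abs_mul]
        nlinarith [abs_nonneg (y a)]
      -- `q - 2` may be negative, so a zero base is treated apart.
      have h2 : |x a + t * y a| ^ (q - 2) * |x a + t * y a| = |x a + t * y a| ^ (q - 1) := by
        rcases (abs_nonneg (x a + t * y a)).eq_or_lt with h | h
        · rw [← h, mul_zero, Real.zero_rpow (by linarith)]
        · rw [← Real.rpow_add_one h.ne']
          congr 1
          ring
      have h3 : |x a + t * y a| ^ (q - 1) ≤ (|x a| + |y a|) ^ (q - 1) :=
        Real.rpow_le_rpow (abs_nonneg _) h1 (by linarith)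
      have h4 : (|x a| + |y a|) ^ (q - 1) * (|x a| + |y a|) = (|x a| + |y a|) ^ q := by
        have h5 : 0 ≤ |x a| + |y a| := by positivity
        rcases h5.eq_or_lt with h | h
        · rw [← h, mul_zero, Real.zero_rpow (by linarith)]
        · rw [← Real.rpow_add_one h.ne']
          congr 1
          ring
      have h6 : 0 ≤ |x a + t * y a| ^ (q - 2) := by positivity
      rw [Real.norm_eq_abs, abs_mul, abs_mul, abs_mul, abs_of_nonneg h6,
        abs_of_nonneg (by linarith : 0 ≤ q), mul_assoc q, h2, ← h4, mul_assoc]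
      have h7 : |y a| ≤ |x a| + |y a| := by linarith [abs_nonneg (x a)]
      gcongr)
    hbound
    (Eventually.of_forall fun a t _ => by
      have h1 : HasDerivAt (fun t : ℝ => x a + t * y a) (y a) t := by
        simpa using ((hasDerivAt_id t).mul_const (y a)).const_add (x a)
      exact (hasDerivAt_abs_rpow (x a + t * y a) hp1).comp t h1)
  have hpos : (∫ a, |x a + 0 * y a| ^ q ∂μ) ≠ 0 := by
    have h := norm_rpow_eq_integral hp0 hp x
    simp only [zero_mul, add_zero]
    rw [← h]
    exact (Real.rpow_pos_of_pos (norm_pos_iff.2 hx) _).ne'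
  rw [funext hnorm]
  exact (hderiv.2.differentiableAt).rpow_const (Or.inl hpos)

end Lp

end MeasureTheory

/-! ### Choosing signs coherently -/

/-- Two vectors agree up to sign. -/
def EqUpToSign {Y : Type*} [AddCommGroup Y] (a b : Y) : Prop := a = b ∨ a = -b

namespace EqUpToSign

variable {Y : Type*} [AddCommGroup Y] {a b c : Y}

theorem refl (a : Y) : EqUpToSign a a := Or.inl rfl

theorem symm (h : EqUpToSign a b) : EqUpToSign b a := by
  rcases h with rfl | rfl
  · exact Or.inl rfl
  · exact Or.inr (neg_neg b).symm

theorem trans (h : EqUpToSign a b) (h' : EqUpToSign b c) : EqUpToSign a c := by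
  rcases h with rfl | rfl
  · exact h'
  · rcases h' with rfl | rfl
    · exact Or.inr rfl
    · exact Or.inl (neg_neg c)

theorem neg_right (h : EqUpToSign a b) : EqUpToSign a (-b) := h.trans (Or.inr (neg_neg b).symm)

theorem smul [Module ℝ Y] (t : ℝ) (h : EqUpToSign a b) : EqUpToSign (t • a) (t • b) := by
  rcases h with rfl | rfl
  · exact Or.inl rfl
  · exact Or.inr (smul_neg t b)

theorem eq_zero (h : EqUpToSign a 0) : a = 0 := by
  rcases h with h | h <;> simpa using h

theorem add_or_sub {a' b' : Y} (ha : EqUpToSign a a') (hb : EqUpToSign b b')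
    (h : EqUpToSign c (a + b) ∨ EqUpToSign c (a - b)) :
    EqUpToSign c (a' + b') ∨ EqUpToSign c (a' - b') := by
  rcases ha with rfl | rfl <;> rcases hb with rfl | rfl
  · exact h
  · rw [← sub_eq_add_neg, sub_neg_eq_add] at h
    exact h.symm
  · refine h.symm.imp (fun h => ?_) fun h => ?_ <;>
    · have := h.neg_right
      convert this using 1
      abel
  · refine h.imp (fun h => ?_) fun h => ?_ <;>
    · have := h.neg_right
      convert this using 1
      abel

end EqUpToSign

/-- A reference vector `x₀` with image `u ≠ 0` fixes every sign: `T x` is the one of `± f x` whose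
sum with `u` is `± f (x + x₀)`. -/
theorem exists_linearMap_of_map_add_smul_up_to_sign {X Y : Type*} [AddCommGroup X] [Module ℝ X]
    [AddCommGroup Y] [Module ℝ Y] (f : X → Y)
    (hadd : ∀ x y, EqUpToSign (f (x + y)) (f x + f y) ∨ EqUpToSign (f (x + y)) (f x - f y))
    (hsmul : ∀ (t : ℝ) x, EqUpToSign (f (t • x)) (t • f x))
    (hinj : ∀ x y, EqUpToSign (f x) (f y) → EqUpToSign x y) :
    ∃ T : X →ₗ[ℝ] Y, ∀ x, EqUpToSign (T x) (f x) := by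
  by_cases hX : ∀ x : X, x = 0
  · refine ⟨0, fun x => ?_⟩
    have h := hsmul 0 0
    rw [zero_smul, zero_smul] at h
    rw [hX x, map_zero]
    exact h.symm
  push Not at hX
  obtain ⟨x₀, hx₀⟩ := hX
  have hf0 : f 0 = 0 := by
    have h := hsmul 0 0
    rw [zero_smul, zero_smul] at h
    exact h.eq_zero
  have hu : f x₀ ≠ 0 := fun h => hx₀ (hinj x₀ 0 (Or.inl (h.trans hf0.symm))).eq_zero
  obtain ⟨u, hu_def⟩ : ∃ u, u = f x₀ := ⟨_, rfl⟩
  rw [← hu_def] at hu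
  have hadd' : ∀ {x y v w}, EqUpToSign (f x) v → EqUpToSign (f y) w →
      EqUpToSign (f (x + y)) (v + w) ∨ EqUpToSign (f (x + y)) (v - w) :=
    fun hx hy => hx.add_or_sub hy (hadd _ _)
  let P : X → Y → Prop := fun x v => EqUpToSign (f x) v ∧ EqUpToSign (f (x + x₀)) (v + u)
  have hex : ∀ x, ∃ v, P x v := by
    intro x
    rcases hadd x x₀ with h | h <;> rw [← hu_def] at h
    · exact ⟨f x, .refl _, h⟩
    · refine ⟨-f x, .neg_right (.refl _), ?_⟩
      convert h.neg_right using 1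
      abel
  have huniq : ∀ x v w, P x v → P x w → v = w := by
    rintro x v w ⟨hv, hv'⟩ ⟨hw, hw'⟩
    rcases hv.symm.trans hw with h | rfl
    · exact h
    rcases hv'.symm.trans hw' with h | h
    · simpa using h
    · refine absurd ?_ hu
      linear_combination (norm := module) (1 / 2 : ℝ) • h
  choose T hT using hex
  have hTeq : ∀ x v, P x v → T x = v := fun x v h => huniq x _ _ (hT x) h
  have hTf : ∀ x, EqUpToSign (f x) (T x) := fun x => (hT x).1
  have hsm : ∀ (t : ℝ) x, EqUpToSign (f (t • x)) (t • T x) := fun t x =>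
    (hsmul t x).trans ((hTf x).smul t)
  have hPline : ∀ c : ℝ, P (c • x₀) (c • u) := by
    intro c
    refine ⟨hu_def ▸ hsmul c x₀, ?_⟩
    have h := hsmul (c + 1) x₀
    rwa [add_smul, one_smul, add_smul, one_smul, ← hu_def] at h
  have hPsmul : ∀ (t : ℝ) x, P (t • x) (t • T x) := by
    intro t x
    by_cases hx : ∃ c : ℝ, x = c • x₀
    · obtain ⟨c, rfl⟩ := hx
      rw [hTeq _ _ (hPline c), smul_smul, smul_smul]
      exact hPline _
    have hind : ∀ c : ℝ, u ≠ c • T x := by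
      intro c hc
      have h1 : EqUpToSign x₀ (c • x) := by
        apply hinj
        rw [← hu_def, hc]
        exact (hsm c x).symm
      have hc0 : c ≠ 0 := by
        rintro rfl
        rw [zero_smul] at h1
        exact hx₀ h1.eq_zero
      rcases h1 with h1 | h1
      · exact hx ⟨c⁻¹, by rw [h1, smul_smul, inv_mul_cancel₀ hc0, one_smul]⟩
      · exact hx ⟨-c⁻¹, by
          rw [h1, smul_neg, neg_smul, neg_neg, smul_smul, inv_mul_cancel₀ hc0, one_smul]⟩
    refine ⟨hsm t x, ?_⟩
    rcases hadd' (hsm t x) (Or.inl hu_def.symm : EqUpToSign (f x₀) u) with h1 | h1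
    · exact h1
    -- With the wrong sign, writing `(t - 1) • x` as `(t • x + x₀) - (x + x₀)` makes `u` a multiple
    -- of `T x` or forces `t • T x = 0`, where both signs agree.
    have h2 := (hsmul (-1) (x + x₀)).trans ((hT x).2.smul (-1))
    have h3 := hadd' h1 h2
    rw [show t • x + x₀ + (-1 : ℝ) • (x + x₀) = (t - 1) • x by module] at h3
    have h4 := (hsm (t - 1) x).symm
    have key : t • T x = 0 → EqUpToSign (f (t • x + x₀)) (t • T x + u) := fun h => by
      rw [h, zero_sub] at h1
      rw [h, zero_add]
      simpa using h1.neg_right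
    rcases h3 with h3 | h3 <;> rcases h4.trans h3 with h | h
    · exact absurd (by linear_combination (norm := module) (1 / 2 : ℝ) • h) (hind 0)
    · exact absurd (by linear_combination (norm := module) (-1 / 2 : ℝ) • h) (hind (t - 1))
    · refine key ?_
      have h5 : T x = 0 := by linear_combination (norm := module) (-1 / 2 : ℝ) • h
      rw [h5, smul_zero]
    · exact key (by linear_combination (norm := module) (1 / 2 : ℝ) • h)
  have hplane : ∀ (t s : ℝ) x, EqUpToSign (f (t • x + s • x₀)) (t • T x + s • u) := by
    intro t s x
    rcases eq_or_ne s 0 with rfl | hs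
    · simpa using hsm t x
    · have h1 : t • x + s • x₀ = s • ((t / s) • x + x₀) := by
        rw [smul_add, smul_smul, mul_div_cancel₀ _ hs]
      have h2 : t • T x + s • u = s • ((t / s) • T x + u) := by
        rw [smul_add, smul_smul, mul_div_cancel₀ _ hs]
      rw [h1, h2]
      exact (hsmul s _).trans ((hPsmul (t / s) x).2.smul s)
  have hTplane : ∀ (t s : ℝ) x, T (t • x + s • x₀) = t • T x + s • u := by
    intro t s x
    refine hTeq _ _ ⟨hplane t s x, ?_⟩
    have h := hplane t (s + 1) x
    rwa [add_smul, one_smul, ← add_assoc, add_smul, one_smul, ← add_assoc] at h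
  have hTsmul : ∀ (t : ℝ) x, T (t • x) = t • T x := fun t x => hTeq _ _ (hPsmul t x)
  have hTinj : ∀ x y, EqUpToSign (T x) (T y) → EqUpToSign x y := fun x y h =>
    hinj x y (((hTf x).trans h).trans (hTf y).symm)
  have hTx₀ : T x₀ = u := by simpa using hTeq _ _ (hPline 1)
  have hTadd_x₀ : ∀ x, EqUpToSign x x₀ → ∀ y, T (x + y) = T x + T y := by
    rintro x (rfl | rfl) y
    · have := hTplane 1 1 y
      simp only [one_smul] at this
      rw [add_comm, this, add_comm, hTx₀]
    · have h1 := hTsmul (-1) x₀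
      have h2 := hTplane 1 (-1) y
      simp only [neg_smul, one_smul] at h1 h2
      rw [add_comm, h2, h1, hTx₀, add_comm]
  have hTadd : ∀ x y, T (x + y) = T x + T y := by
    intro x y
    by_cases hx : EqUpToSign x x₀
    · exact hTadd_x₀ x hx y
    by_cases hy : EqUpToSign y x₀
    · rw [add_comm, hTadd_x₀ y hy x, add_comm]
    by_cases hxy : EqUpToSign x y
    · rcases hxy with rfl | rfl
      · rw [← two_smul ℝ x, hTsmul, two_smul]
      · have h1 := hTsmul (-1) y
        have h2 := hTsmul 0 y
        simp only [neg_smul, one_smul, zero_smul] at h1 h2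
        rw [neg_add_cancel, h1, h2, neg_add_cancel]
    have h1 := hadd' (hT x).2 (hTf y)
    have h2 := hadd' (hT y).2 (hTf x)
    rw [show x + x₀ + y = x + y + x₀ by abel] at h1
    rw [show y + x₀ + x = x + y + x₀ by abel] at h2
    -- Two groupings of `x + y + x₀`: if both carry a minus sign, then `T x = T y` or `u = 0`.
    have hsum : EqUpToSign (f (x + y + x₀)) (T x + T y + u) := by
      rcases h1 with h1 | h1
      · convert h1 using 1
        abel
      rcases h2 with h2 | h2
      · convert h2 using 1
        abel
      rcases h1.symm.trans h2 with h | h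
      · refine absurd (hTinj x y (Or.inl ?_)) hxy
        linear_combination (norm := module) (1 / 2 : ℝ) • h
      · refine absurd ?_ hu
        linear_combination (norm := module) (1 / 2 : ℝ) • h
    refine hTeq _ _ ⟨?_, hsum⟩
    rcases hadd' (hTf x) (hTf y) with h | h
    · exact h
    have key : T x = 0 ∨ T y = 0 → EqUpToSign (f (x + y)) (T x + T y) := by
      rintro (h0 | h0) <;> rw [h0] at h ⊢
      · simpa using h.neg_right
      · simpa using h
    -- A difference `T x - T y`, followed by `± u`, matches `hsum` only if `T x` or `T y` is 0 or
    -- `-u`.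
    rcases hadd' h (Or.inl hu_def.symm : EqUpToSign (f x₀) u) with h3 | h3 <;>
      rcases hsum.symm.trans h3 with h4 | h4
    · exact key (Or.inr (by linear_combination (norm := module) (1 / 2 : ℝ) • h4))
    · refine absurd (hTinj x x₀ (Or.inr ?_)) hx
      rw [hTx₀]
      linear_combination (norm := module) (1 / 2 : ℝ) • h4
    · refine absurd (hTinj y x₀ (Or.inr ?_)) hy
      rw [hTx₀]
      linear_combination (norm := module) (1 / 2 : ℝ) • h4
    · exact key (Or.inl (by linear_combination (norm := module) (1 / 2 : ℝ) • h4))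
  exact ⟨⟨⟨T, hTadd⟩, hTsmul⟩, fun x => (hTf x).symm⟩

/-! ### Support functionals and Birkhoff orthogonality -/

/-- The norm minus its affine minorant from `g` is minimal at `t = 0`, so its derivative there
vanishes. -/
theorem hasDerivAt_norm_add_smul_of_support {X : Type*} [NormedAddCommGroup X] [NormedSpace ℝ X]
    {x y : X} (hd : DifferentiableAt ℝ (fun t : ℝ => ‖x + t • y‖) 0)
    {g : StrongDual ℝ X} (hg : ‖g‖ ≤ 1) (hgx : g x = ‖x‖) :
    HasDerivAt (fun t : ℝ => ‖x + t • y‖) (g y) 0 := by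
  have h1 : HasDerivAt (fun t : ℝ => ‖x + t • y‖ - (‖x‖ + t * g y))
      (deriv (fun t : ℝ => ‖x + t • y‖) 0 - g y) 0 := by
    refine hd.hasDerivAt.sub ?_
    simpa using ((hasDerivAt_id (0 : ℝ)).mul_const (g y)).const_add ‖x‖
  have h2 : IsLocalMin (fun t : ℝ => ‖x + t • y‖ - (‖x‖ + t * g y)) 0 := by
    refine Eventually.of_forall fun t => ?_
    have h3 : g (x + t • y) ≤ ‖x + t • y‖ :=
      (le_abs_self _).trans ((g.le_of_opNorm_le hg _).trans_eq (one_mul _))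
    rw [map_add, map_smul, hgx, smul_eq_mul] at h3
    simpa using h3
  have h3 := h2.hasDerivAt_eq_zero h1
  have h4 := hd.hasDerivAt
  rwa [sub_eq_zero.1 h3] at h4

/-- If `‖u‖ ≤ ‖u + t • v‖` for all `u` in a nonempty open set and all `t`, in a space where distinct
vectors of equal norm have a midpoint of smaller norm, then `v = 0`. -/
theorem eq_zero_of_interior_birkhoffOrthogonal_nonempty {Y : Type*} [NormedAddCommGroup Y]
    [NormedSpace ℝ Y] (hY : ∀ u w : Y, ‖u‖ = ‖w‖ → ‖u + w‖ = ‖u‖ + ‖w‖ → u = w) {v : Y}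
    (h : (interior {u : Y | ∀ t : ℝ, ‖u‖ ≤ ‖u + t • v‖}).Nonempty) : v = 0 := by
  obtain ⟨u, hu⟩ := h
  have hnhds : ∀ᶠ t : ℝ in 𝓝 0, ∀ s : ℝ, ‖u + t • v‖ ≤ ‖u + t • v + s • v‖ := by
    have hc : ContinuousAt (fun t : ℝ => u + t • v) 0 := by fun_prop
    have hm : ∀ᶠ w in 𝓝 (u + (0 : ℝ) • v), ∀ s : ℝ, ‖w‖ ≤ ‖w + s • v‖ := by
      rw [zero_smul, add_zero]
      exact mem_interior_iff_mem_nhds.1 hu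
    exact hc.eventually hm
  obtain ⟨t, ht, ht0⟩ := ((hnhds.filter_mono nhdsWithin_le_nhds).and
    (self_mem_nhdsWithin : Set.Ioi (0 : ℝ) ∈ 𝓝[>] 0)).exists
  have hu0 : ∀ s : ℝ, ‖u‖ ≤ ‖u + s • v‖ := interior_subset hu
  -- Both points minimise the norm on the line `u + ℝ v`, so their midpoint has norm no smaller.
  have h1 : ‖u‖ = ‖u + t • v‖ := le_antisymm (hu0 t) (by simpa using ht (-t))
  have h2 : ‖u + (u + t • v)‖ = ‖u‖ + ‖u + t • v‖ := by
    refine le_antisymm (norm_add_le _ _) ?_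
    have h3 : u + (u + t • v) = (2 : ℝ) • (u + (t / 2) • v) := by module
    rw [h3, norm_smul, Real.norm_two, ← h1]
    linarith [hu0 (t / 2)]
  have h3 := hY _ _ h1 h2
  rw [left_eq_add, smul_eq_zero] at h3
  exact h3.resolve_left (ne_of_gt ht0)

theorem isClosed_birkhoffOrthogonal {Y : Type*} [NormedAddCommGroup Y] [NormedSpace ℝ Y] (v : Y) :
    IsClosed {u : Y | ∀ t : ℝ, ‖u‖ ≤ ‖u + t • v‖} := by
  simp only [Set.ofPred_forall]
  exact isClosed_iInter fun t => isClosed_le (by fun_prop) (by fun_prop)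

/-- A finite cover needs no Baire category, so `Y` need not be complete. -/
theorem exists_interior_nonempty_of_union_eq_univ {Y : Type*} [TopologicalSpace Y] [Nonempty Y]
    {A B C D : Set Y} (hA : IsClosed A) (hB : IsClosed B) (hC : IsClosed C)
    (h : A ∪ (B ∪ (C ∪ D)) = Set.univ) :
    (interior A).Nonempty ∨ (interior B).Nonempty ∨ (interior C).Nonempty ∨
      (interior D).Nonempty := by
  by_contra! hcon
  obtain ⟨h1, h2, h3, h4⟩ := hcon
  have h5 : interior (A ∪ (B ∪ (C ∪ D))) = ∅ := by
    have hunion : ∀ {s t : Set Y}, IsClosed s → interior s = ∅ → interior t = ∅ →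
        interior (s ∪ t) = ∅ := fun hs h h' => by
      rw [interior_union_isClosed_of_interior_empty hs h', h]
    exact hunion hA h1 (hunion hB h2 (hunion hC h3 h4))
  rw [h, interior_univ] at h5
  exact Set.univ_nonempty.ne_empty h5

/-! ### Phase-isometries -/

namespace IsPhaseIsometry

variable {X Y : Type*} [NormedAddCommGroup X] [NormedSpace ℝ X] [NormedAddCommGroup Y]
  [NormedSpace ℝ Y] {f : X → Y}

theorem cases (hf : IsPhaseIsometry f) (x y : X) :
    (‖f x + f y‖ = ‖x + y‖ ∧ ‖f x - f y‖ = ‖x - y‖) ∨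
      (‖f x + f y‖ = ‖x - y‖ ∧ ‖f x - f y‖ = ‖x + y‖) :=
  Set.pair_eq_pair_iff.1 (hf x y)

theorem norm_map (hf : IsPhaseIsometry f) (x : X) : ‖f x‖ = ‖x‖ := by
  have hx : ‖x + x‖ = 2 * ‖x‖ := by rw [← two_smul ℝ, norm_smul, Real.norm_two]
  have hfx : ‖f x + f x‖ = 2 * ‖f x‖ := by rw [← two_smul ℝ, norm_smul, Real.norm_two]
  rcases hf.cases x x with ⟨h, h'⟩ | ⟨h, h'⟩ <;> rw [sub_self, norm_zero] at * <;> linarith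

theorem eqUpToSign_of_map (hf : IsPhaseIsometry f) {x y : X} (h : EqUpToSign (f x) (f y)) :
    EqUpToSign x y := by
  have h0 : ‖f x + f y‖ = 0 ∨ ‖f x - f y‖ = 0 := by
    rcases h with h | h
    · exact Or.inr (by rw [h, sub_self, norm_zero])
    · exact Or.inl (by rw [h, neg_add_cancel, norm_zero])
  have h1 : ‖x - y‖ = 0 ∨ ‖x + y‖ = 0 := by
    rcases hf.cases x y with ⟨h, h'⟩ | ⟨h, h'⟩ <;> rw [h, h'] at h0
    · exact h0.symm
    · exact h0
  exact h1.imp (fun h => sub_eq_zero.1 (norm_eq_zero.1 h))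
    fun h => eq_neg_of_add_eq_zero_left (norm_eq_zero.1 h)

theorem map_eqUpToSign (hf : IsPhaseIsometry f) {x y : X} (h : EqUpToSign x y) :
    EqUpToSign (f x) (f y) := by
  have h0 : ‖x + y‖ = 0 ∨ ‖x - y‖ = 0 := by
    rcases h with h | h
    · exact Or.inr (by rw [h, sub_self, norm_zero])
    · exact Or.inl (by rw [h, neg_add_cancel, norm_zero])
  have h1 : ‖f x - f y‖ = 0 ∨ ‖f x + f y‖ = 0 := by
    rcases hf.cases x y with ⟨h, h'⟩ | ⟨h, h'⟩ <;> rw [h, h']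
    · exact h0.symm
    · exact h0
  exact h1.imp (fun h => sub_eq_zero.1 (norm_eq_zero.1 h))
    fun h => eq_neg_of_add_eq_zero_left (norm_eq_zero.1 h)

/-- Equality in the triangle inequality for images forces equality for the preimages, up to sign. -/
theorem sameRay_or_sameRay_neg [StrictConvexSpace ℝ X] (hf : IsPhaseIsometry f) {x y : X}
    (h : ‖f x + f y‖ = ‖f x‖ + ‖f y‖) : SameRay ℝ x y ∨ SameRay ℝ x (-y) := by
  rw [sameRay_iff_norm_add, sameRay_iff_norm_add, norm_neg, ← sub_eq_add_neg]
  rw [hf.norm_map, hf.norm_map] at h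
  rcases hf.cases x y with ⟨h1, -⟩ | ⟨h1, -⟩
  · exact Or.inl (h1 ▸ h)
  · exact Or.inr (h1 ▸ h)

/-- Strict convexity is carried from `X` to `Y` through preimages under `f`. -/
theorem eq_of_norm_add_eq [StrictConvexSpace ℝ X] (hf : IsPhaseIsometry f)
    (hsurj : Function.Surjective f) (u w : Y) (h : ‖u‖ = ‖w‖) (h' : ‖u + w‖ = ‖u‖ + ‖w‖) :
    u = w := by
  obtain ⟨x, rfl⟩ := hsurj u
  obtain ⟨y, rfl⟩ := hsurj w
  have hxy : ‖x‖ = ‖y‖ := by rwa [hf.norm_map, hf.norm_map] at h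
  have h1 : EqUpToSign x y := (hf.sameRay_or_sameRay_neg h').imp (fun h => h.eq_of_norm_eq hxy)
    fun h => h.eq_of_norm_eq (by rwa [norm_neg])
  rcases hf.map_eqUpToSign h1 with h2 | h2
  · exact h2
  · rw [h2, neg_add_cancel, norm_zero, norm_neg] at h'
    have h3 : f y = 0 := norm_eq_zero.1 (by linarith)
    rw [h2, h3, neg_zero]

/-- For `t ≥ 0`, a preimage `y` of `t • f x` gives equality in the triangle inequality, so `x` lies
on the ray of `y` or `-y`; norms then identify `t • x` with `± y`. -/
theorem map_smul [StrictConvexSpace ℝ X] (hf : IsPhaseIsometry f)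
    (hsurj : Function.Surjective f) (t : ℝ) (x : X) : EqUpToSign (f (t • x)) (t • f x) := by
  have hnonneg : ∀ t : ℝ, 0 ≤ t → EqUpToSign (f (t • x)) (t • f x) := by
    intro t ht
    obtain ⟨y, hy⟩ := hsurj (t • f x)
    rw [← hy]
    apply hf.map_eqUpToSign
    have hn : ‖t • x‖ = ‖y‖ := by
      rw [← hf.norm_map y, hy, norm_smul, norm_smul, hf.norm_map]
    have h1 : ‖f x + f y‖ = ‖f x‖ + ‖f y‖ := by
      rw [hy]
      exact ((SameRay.refl (f x)).nonneg_smul_right ht).norm_add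
    exact (hf.sameRay_or_sameRay_neg h1).imp
      (fun h => (h.nonneg_smul_left ht).eq_of_norm_eq hn)
      fun h => (h.nonneg_smul_left ht).eq_of_norm_eq (by rwa [norm_neg])
  rcases le_total 0 t with ht | ht
  · exact hnonneg t ht
  · have h1 := hnonneg (-t) (by linarith)
    rw [neg_smul, neg_smul] at h1
    have h2 : EqUpToSign (t • x) (-(t • x)) := (EqUpToSign.refl _).neg_right
    simpa using ((hf.map_eqUpToSign h2).trans h1).neg_right

theorem sq_support_apply_eq (hf : IsPhaseIsometry f)
    (hsmul : ∀ (t : ℝ) x, EqUpToSign (f (t • x)) (t • f x)) {z x : X}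
    (hd : DifferentiableAt ℝ (fun t : ℝ => ‖z + t • x‖) 0)
    {g : StrongDual ℝ X} (hg : ‖g‖ ≤ 1) (hgz : g z = ‖z‖)
    {ψ : StrongDual ℝ Y} (hψ : ‖ψ‖ ≤ 1) (hψz : ψ (f z) = ‖f z‖) :
    ψ (f x) = g x ∨ ψ (f x) = -g x := by
  have hle : ∀ w : Y, ψ w ≤ ‖w‖ := fun w =>
    (le_abs_self _).trans ((ψ.le_of_opNorm_le hψ _).trans_eq (one_mul _))
  have h1 := hasDerivAt_norm_add_smul_of_support hd hg hgz
  have h2 : HasDerivAt (fun t : ℝ => ‖z - t • x‖) (-g x) 0 := by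
    have h3 : HasDerivAt (fun t : ℝ => ‖z + t • x‖) (g x) (-0) := by rwa [neg_zero]
    have h4 := h3.scomp (0 : ℝ) (hasDerivAt_neg (0 : ℝ))
    simpa [Function.comp_def, sub_eq_add_neg] using h4
  have t1 := h1.tendsto_slope_zero_right
  have t2 := h2.tendsto_slope_zero_right
  simp only [zero_add, zero_smul, add_zero, sub_zero, smul_eq_mul] at t1 t2
  set b := ψ (f x)
  -- `ψ` bounds the two quotients below by `b` and `-b` in some order, possibly depending on `t`.
  -- Their maximum and minimum ignore the order and tend to `± |g x|`.
  have hcase : ∀ t : ℝ, 0 < t →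
      (b ≤ t⁻¹ * (‖z + t • x‖ - ‖z‖) ∧ -b ≤ t⁻¹ * (‖z - t • x‖ - ‖z‖)) ∨
      (-b ≤ t⁻¹ * (‖z + t • x‖ - ‖z‖) ∧ b ≤ t⁻¹ * (‖z - t • x‖ - ‖z‖)) := by
    intro t ht
    have hp : t * b ≤ ‖f z + t • f x‖ - ‖z‖ := by
      have h := hle (f z + t • f x)
      rw [map_add, _root_.map_smul, hψz, hf.norm_map, smul_eq_mul] at h
      linarith
    have hm : t * -b ≤ ‖f z - t • f x‖ - ‖z‖ := by
      have h := hle (f z - t • f x)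
      rw [map_sub, _root_.map_smul, hψz, hf.norm_map, smul_eq_mul] at h
      linarith
    have hpair : (‖f z + t • f x‖ = ‖z + t • x‖ ∧ ‖f z - t • f x‖ = ‖z - t • x‖) ∨
        (‖f z + t • f x‖ = ‖z - t • x‖ ∧ ‖f z - t • f x‖ = ‖z + t • x‖) := by
      have h := hf.cases z (t • x)
      rcases hsmul t x with h' | h' <;> rw [h'] at h
      · exact h
      · rw [← sub_eq_add_neg, sub_neg_eq_add] at h
        tauto
    simp only [le_inv_mul_iff₀ ht]
    rcases hpair with ⟨h, h'⟩ | ⟨h, h'⟩ <;> rw [h] at hp <;> rw [h'] at hm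
    · exact Or.inl ⟨hp, hm⟩
    · exact Or.inr ⟨hm, hp⟩
  have hmax : |b| ≤ |g x| := by
    refine ge_of_tendsto (t1.max t2) ?_
    filter_upwards [self_mem_nhdsWithin] with t ht
    rcases hcase t ht with ⟨h, h'⟩ | ⟨h, h'⟩
    · exact max_le_max h h'
    · rw [abs_eq_max_neg, max_comm]
      exact max_le_max h h'
  have hmin : -|b| ≤ -|g x| := by
    have h := t1.min t2
    have h3 : min (g x) (-g x) = -|g x| := by
      rw [abs_eq_max_neg, ← min_neg_neg, neg_neg, min_comm]
    rw [h3] at h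
    refine ge_of_tendsto h ?_
    filter_upwards [self_mem_nhdsWithin] with t ht
    have hb := neg_abs_le b
    have hb' := neg_le_neg (le_abs_self b)
    rcases hcase t ht with ⟨h, h'⟩ | ⟨h, h'⟩
    · exact le_min (hb.trans h) (hb'.trans h')
    · exact le_min (hb'.trans h) (hb.trans h')
  exact abs_eq_abs.1 (le_antisymm hmax (neg_le_neg_iff.1 hmin))

theorem map_add [StrictConvexSpace ℝ X] (hf : IsPhaseIsometry f)
    (hsurj : Function.Surjective f)
    (hd : ∀ x y : X, x ≠ 0 → DifferentiableAt ℝ (fun t : ℝ => ‖x + t • y‖) 0) (x y : X) :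
    EqUpToSign (f (x + y)) (f x + f y) ∨ EqUpToSign (f (x + y)) (f x - f y) := by
  let A : Y → Set Y := fun v => {u : Y | ∀ t : ℝ, ‖u‖ ≤ ‖u + t • v‖}
  have hcover : A (f (x + y) - (f x + f y)) ∪ (A (f (x + y) + (f x + f y)) ∪
      (A (f (x + y) - (f x - f y)) ∪ A (f (x + y) + (f x - f y)))) = Set.univ := by
    refine Set.eq_univ_of_forall fun u => ?_
    obtain ⟨z, rfl⟩ := hsurj u
    rcases eq_or_ne z 0 with rfl | hz
    · refine Or.inl fun t => ?_
      rw [hf.norm_map, norm_zero]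
      exact norm_nonneg _
    obtain ⟨g, hg, hgz⟩ := exists_dual_vector'' ℝ z
    obtain ⟨ψ, hψ, hψz⟩ := exists_dual_vector'' ℝ (f z)
    have hz' : ∀ x, ψ (f x) = g x ∨ ψ (f x) = -g x := fun x =>
      hf.sq_support_apply_eq (hf.map_smul hsurj) (hd z x hz) hg hgz hψ hψz
    have hmem : ∀ v, ψ v = 0 → f z ∈ A v := by
      intro v hv t
      have h := (le_abs_self _).trans ((ψ.le_of_opNorm_le hψ (f z + t • v)).trans_eq (one_mul _))
      rw [_root_.map_add, _root_.map_smul, hv, smul_zero, add_zero, hψz] at h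
      exact h
    have h1 := hz' x
    have h2 := hz' y
    have h3 := hz' (x + y)
    rw [_root_.map_add] at h3
    -- The three values are `± g x`, `± g y`, `± (g x + g y)`; some choice of signs cancels them.
    have h4 : ψ (f (x + y) - (f x + f y)) = 0 ∨ ψ (f (x + y) + (f x + f y)) = 0 ∨
        ψ (f (x + y) - (f x - f y)) = 0 ∨ ψ (f (x + y) + (f x - f y)) = 0 := by
      simp only [_root_.map_add, map_sub]
      rcases h1 with h1 | h1 <;> rcases h2 with h2 | h2 <;> rcases h3 with h3 | h3 <;>
        rw [h1, h2, h3] <;> ring_nf <;> simp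
    exact h4.imp (hmem _) (Or.imp (hmem _) (Or.imp (hmem _) (hmem _)))
  have hzero : ∀ v, (interior (A v)).Nonempty → v = 0 := fun v =>
    eq_zero_of_interior_birkhoffOrthogonal_nonempty (hf.eq_of_norm_add_eq hsurj)
  rcases exists_interior_nonempty_of_union_eq_univ (isClosed_birkhoffOrthogonal _)
    (isClosed_birkhoffOrthogonal _) (isClosed_birkhoffOrthogonal _) hcover with h | h | h | h
  · exact Or.inl (Or.inl (sub_eq_zero.1 (hzero _ h)))
  · exact Or.inl (Or.inr (eq_neg_of_add_eq_zero_left (hzero _ h)))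
  · exact Or.inr (Or.inl (sub_eq_zero.1 (hzero _ h)))
  · exact Or.inr (Or.inr (eq_neg_of_add_eq_zero_left (hzero _ h)))

/-- A surjective phase-isometry on a strictly convex space with Gateaux differentiable norm is
phase-equivalent to a linear isometry. -/
theorem isPhaseEquivalentToLinearIsometry [StrictConvexSpace ℝ X] (hf : IsPhaseIsometry f)
    (hsurj : Function.Surjective f)
    (hd : ∀ x y : X, x ≠ 0 → DifferentiableAt ℝ (fun t : ℝ => ‖x + t • y‖) 0) :
    IsPhaseEquivalentToLinearIsometry f := by
  obtain ⟨T, hT⟩ := exists_linearMap_of_map_add_smul_up_to_sign f (hf.map_add hsurj hd)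
    (hf.map_smul hsurj) fun x y h => hf.eqUpToSign_of_map h
  have hex : ∀ x, ∃ e : ℝ, (e = -1 ∨ e = 1) ∧ e • f x = T x := by
    intro x
    rcases hT x with h | h
    · exact ⟨1, Or.inr rfl, by rw [h, one_smul]⟩
    · exact ⟨-1, Or.inl rfl, by rw [h, neg_smul, one_smul]⟩
  choose ε hε hεT using hex
  refine ⟨ε, hε, ⟨T, fun x => ?_⟩, hεT⟩
  rcases hT x with h | h <;> rw [h]
  · exact hf.norm_map x
  · rw [norm_neg, hf.norm_map]

end IsPhaseIsometry

theorem corollary2p9 {Ω Y : Type*} [MeasurableSpace Ω] (μ : MeasureTheory.Measure Ω)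
    (p : ENNReal) [Fact (1 ≤ p)] (hp_one : 1 < p) (hp_top : p < ⊤)
    [NormedAddCommGroup Y] [NormedSpace ℝ Y]
    (f : MeasureTheory.Lp ℝ p μ → Y) (hf_surj : Function.Surjective f)
    (hf : IsPhaseIsometry f) :
    IsPhaseEquivalentToLinearIsometry f := by
  have := MeasureTheory.Lp.strictConvexSpace (μ := μ) hp_one hp_top.ne
  exact hf.isPhaseEquivalentToLinearIsometry hf_surj fun _ y hx =>
    MeasureTheory.Lp.differentiableAt_norm_add_smul hp_one hp_top.ne hx y
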